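/- Let $n\ge 1$. For $0\le i,j\le n-1$ let $\mu_{i,j}=(n^i,j^{n-i})\subset n\times n$ (the complement in the $n\times n$ square of a rectangle in the bottom right corner). Let $G_n$ be the following planar directed graph in a disk (the co-rectangles plabic graph of $\mathrm{LGr}(n,2n)$ with its perfect orientation with source set $\{1,\dots,n\}$). It has boundary vertices $1,\dots,2n$, and internal vertices $h$ (hollow), $a$ (filled), and $\bullet_{c,r}$ (filled), $\circ_{c,r}$ (hollow) for $1\le c,r\le n-1$. Its edges are: $n\to h\to a\to n+1$; upward vertical strands $c\to\bullet_{c,1}\to\circ_{c,1}\to\bullet_{c,2}\to\circ_{c,2}\to\cdots\to\circ_{c,n-1}\to a$, numbered by $c$ from right to left; and rightward horizontal strands $h\to\bullet_{n-1,r}\to\circ_{n-1,r}\to\bullet_{n-2,r}\to\cdots\to\circ_{1,r}\to 2n+1-r$, numbered by $r$ from bottom to top (the edge $\bullet_{c,r}\to\circ_{c,r}$ is common to strands $c$ and $r$, with $\bullet_{c,r}$ at the lower left and $\circ_{c,r}$ at the upper right of the crossing). The face with exactly $i$ vertical strands to its right and $j$ horizontal strands below it is labelled $\mu_{i,j}$,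 and the upper left corner face, cut off by the path $n\to h\to a\to n+1$, is labelled by the full square $n\times n$. To a Young diagram $\lambda\subset n\times n$ associate the $n$-subset $J_\lambda\subset[2n]$ of labels of the vertical steps of the lattice path which bounds $\lambda$ and runs from the upper right to the lower left corner of the square, its unit steps being labelled $1,\dots,2n$. A flow from $[n]$ to $J_\lambda$ is a collection of pairwise vertex-disjoint directed paths in $G_n$ with set of sources $[n]\setminus J_\lambda$ and set of sinks $J_\lambda\setminus[n]$; its weight is the product over its paths of the products of the variables $x_\mu$ over all faces $\mu$ to the left of the path. The Plücker coordinate $p_\lambda$ of $\mathrm{LGr}(n,2n)$ is expressed on the network torus as the sum of the weights of all flows from $[n]$ to $J_\lambda$, where $x_\mu$ and $x_{\mu^T}$ are identified. Fix any total order of the torus coordinates $x_\mu=x_{\mu^T}$, and let $\operatorname{val}(p_\lambda)$ be the exponent vector of the lexicographically minimal term of this polynomial. Let $M_n$ be the $\binom{n+1}{2}\times\binom{n+1}{2}$ integer matrix with the entries $\operatorname{val}(p_\lambda)_\mu$, where * the columns are indexed by the diagrams $\lambda$ with $(n-1)\times(n-1)\subseteq\lambda\subsetneq n\times n$ that have at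 least as many boxes to the right of the main diagonal as below it, i.e. by the diagrams $\lambda_{i,j}$, $0\le i\le j\le n-1$, which consist of the $(n-1)\times(n-1)$ square, the top $j$ boxes of the last column and the leftmost $i$ boxes of the last row of the $n\times n$ square; they are ordered by increasing $i$ and, for equal $i$, by decreasing $j$; * the rows are indexed by the nonempty face labels up to transposition, i.e. by $\mu_{i,j}$ with $0\le j\le i\le n-1$, $(i,j)\ne(0,0)$, ordered by increasing $j$ and, for equal $j$, by increasing $i$, followed by the full square $n\times n$ as the last one. Then $M_n$ is unimodular, i.e. $\det M_n=\pm1$. Moreover, $M_n$ can be transformed by a finite sequence of elementary integral column operations alone (adding an integer multiple of a column to another column, exchanging two columns, multiplying a column by $-1$) into a lower triangular matrix with all diagonal entries equal to $1$. -/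

import Mathlib

/-! The co-rectangles network for the Lagrangian Grassmannian `LGr(n, 2n)`: its plabic graph with
its perfect orientation, flow polynomials, the associated lowest term valuation, and the matrix
`M n` whose columns are valuations of Plücker coordinates. -/

namespace CoRect

/-! ### Young diagrams in the `n × n` square, and `n`-subsets of `[2n]` -/

/-- The Young diagram `(n^i, j^(n-i))` (for `i, j ≤ n`): the complement in the `n × n` square of
the bottom-right rectangle with `n - i` rows and `n - j` columns. Cells are pairs (row, column),
counted from `0`. -/
def rectCompl (n i j : ℕ) : YoungDiagram where
  cells := (Finset.range n ×ˢ Finset.range n).filter fun p => p.1 < i ∨ p.2 < j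
  isLowerSet := by
    intro p q hqp hp
    have h1 := hqp.1
    have h2 := hqp.2
    simp only [Finset.coe_filter, Finset.mem_product, Finset.mem_range, Set.mem_ofPred_eq] at hp ⊢
    omega

/-- The Young diagram consisting of the `(n-1) × (n-1)` square, the top `j` boxes of the last
column of the `n × n` square, and the leftmost `i` boxes of its last row (for `i, j ≤ n - 1`). -/
def nearSquare (n i j : ℕ) : YoungDiagram where
  cells := (Finset.range n ×ˢ Finset.range n).filter fun p =>
    (p.1 < n - 1 ∧ p.2 < n - 1) ∨ p.1 < j ∨ p.2 < i
  isLowerSet := by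
    intro p q hqp hp
    have h1 := hqp.1
    have h2 := hqp.2
    simp only [Finset.coe_filter, Finset.mem_product, Finset.mem_range, Set.mem_ofPred_eq] at hp ⊢
    omega

/-- The `n`-subset of `[2n]` of a diagram `lam` inside the `n × n` square: walk along the boundary
of `lam` from the upper right to the lower left corner of the square with unit steps labelled
`1, …, 2n`, and take the labels of the vertical steps. The vertical step in row `r` (from `0`) comes
after `r` vertical and `n - lam_r` horizontal steps. The element `k : Fin (2 * n)` stands for the
label `k + 1`. -/
def subsetOf (n : ℕ) (lam : YoungDiagram) : Finset (Fin (2 * n)) :=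
  Finset.univ.image fun r : Fin n => ⟨n - lam.rowLen r + r, by have := r.isLt; omega⟩

/-! ### The plabic graph, its faces and its perfect orientation

The graph is a grid of `n - 1` vertical strands and `n - 1` horizontal strands. Vertical strands are
numbered `0, …, n-2` from right to left, horizontal strands `0, …, n-2` from bottom to top. The
crossing of strands `c` and `r` is resolved into a filled vertex `filled c r` (bottom left) and a
hollow vertex `hollow c r` (upper right), joined by an edge. There are two more internal vertices:
the hollow vertex `hub`, where all horizontal strands begin on the left, and the filled vertex
`apex`, where all vertical strands end at the top. -/

/-- Vertices; `bdry k` is the boundary vertex with label `k + 1`. -/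
inductive Vertex (n : ℕ) : Type
  | bdry (k : Fin (2 * n))
  | hub
  | apex
  | filled (c r : Fin (n - 1))
  | hollow (c r : Fin (n - 1))
  deriving DecidableEq, Fintype

/-- Faces. `cell i j` has exactly `i` vertical strands to its right and `j` horizontal strands
below it; `outer` is the face in the upper left corner, cut off by the edge from `hub` to `apex`. -/
inductive Face (n : ℕ) : Type
  | outer
  | cell (i j : Fin n)
  deriving DecidableEq, Fintype

/-- The Young diagram labelling a face. -/
def Face.label {n : ℕ} : Face n → YoungDiagram
  | .outer => rectCompl n n n
  | .cell i j => rectCompl n i j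

/-- `Arrow n u v L R`: there is an edge, directed from `u` to `v`, with the face `L` on its left and
the face `R` on its right. Vertical strands run upwards, horizontal strands to the right. -/
inductive Arrow (n : ℕ) : Vertex n → Vertex n → Face n → Face n → Prop
  /-- from the boundary vertex labelled `n` to the hub -/
  | sourceHub (k : Fin (2 * n)) (i j : Fin n) (hk : (k : ℕ) + 1 = n) (hi : (i : ℕ) + 1 = n)
      (hj : (j : ℕ) = 0) : Arrow n (.bdry k) .hub .outer (.cell i j)
  | hubApex (i : Fin n) (hi : (i : ℕ) + 1 = n) : Arrow n .hub .apex .outer (.cell i i)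
  /-- from the apex to the boundary vertex labelled `n + 1` -/
  | apexSink (k : Fin (2 * n)) (i j : Fin n) (hk : (k : ℕ) = n) (hi : (i : ℕ) = 0)
      (hj : (j : ℕ) + 1 = n) : Arrow n .apex (.bdry k) .outer (.cell i j)
  /-- from the boundary vertex labelled `c + 1` into the vertical strand `c` -/
  | sourceUp (c r : Fin (n - 1)) (k : Fin (2 * n)) (iL iR j : Fin n) (hr : (r : ℕ) = 0)
      (hk : (k : ℕ) = c) (hL : (iL : ℕ) = c + 1) (hR : (iR : ℕ) = c) (hj : (j : ℕ) = 0) :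
      Arrow n (.bdry k) (.filled c r) (.cell iL j) (.cell iR j)
  /-- along the vertical strand `c`, from horizontal strand `r` to the next -/
  | up (c r r' : Fin (n - 1)) (iL iR j : Fin n) (hr : (r' : ℕ) = r + 1)
      (hL : (iL : ℕ) = c + 1) (hR : (iR : ℕ) = c) (hj : (j : ℕ) = r + 1) :
      Arrow n (.hollow c r) (.filled c r') (.cell iL j) (.cell iR j)
  /-- the last edge of the vertical strand `c` -/
  | upApex (c r : Fin (n - 1)) (iL iR j : Fin n) (hr : (r : ℕ) + 2 = n)
      (hL : (iL : ℕ) = c + 1) (hR : (iR : ℕ) = c) (hj : (j : ℕ) + 1 = n) :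
      Arrow n (.hollow c r) .apex (.cell iL j) (.cell iR j)
  /-- the first edge of the horizontal strand `r` -/
  | hubRight (c r : Fin (n - 1)) (i jL jR : Fin n) (hc : (c : ℕ) + 2 = n)
      (hi : (i : ℕ) + 1 = n) (hL : (jL : ℕ) = r + 1) (hR : (jR : ℕ) = r) :
      Arrow n .hub (.filled c r) (.cell i jL) (.cell i jR)
  /-- along the horizontal strand `r`, from vertical strand `c` to the next -/
  | right (c c' r : Fin (n - 1)) (i jL jR : Fin n) (hc : (c : ℕ) = c' + 1)
      (hi : (i : ℕ) = c) (hL : (jL : ℕ) = r + 1) (hR : (jR : ℕ) = r) :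
      Arrow n (.hollow c r) (.filled c' r) (.cell i jL) (.cell i jR)
  /-- from the horizontal strand `r` to the boundary vertex labelled `2n - r` -/
  | rightSink (c r : Fin (n - 1)) (k : Fin (2 * n)) (i jL jR : Fin n) (hc : (c : ℕ) = 0)
      (hk : (k : ℕ) + 1 + r = 2 * n) (hi : (i : ℕ) = 0) (hL : (jL : ℕ) = r + 1)
      (hR : (jR : ℕ) = r) :
      Arrow n (.hollow c r) (.bdry k) (.cell i jL) (.cell i jR)
  /-- the edge between the two vertices of a resolved crossing -/
  | cross (c r : Fin (n - 1)) (iL iR jL jR : Fin n) (hiL : (iL : ℕ) = c + 1)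
      (hiR : (iR : ℕ) = c) (hjL : (jL : ℕ) = r + 1) (hjR : (jR : ℕ) = r) :
      Arrow n (.filled c r) (.hollow c r) (.cell iL jL) (.cell iR jR)

/-- There is an edge directed from `u` to `v`. -/
def Adj (n : ℕ) (u v : Vertex n) : Prop := ∃ L R, Arrow n u v L R

/-- The orientation is perfect with source set `{1, …, n}`: each filled internal vertex has exactly
one outgoing edge, each hollow internal vertex has exactly one incoming edge, the boundary vertices
`1, …, n` have an outgoing and no incoming edge, and `n + 1, …, 2n` an incoming and no outgoing
one. -/
theorem orientation_perfect (n : ℕ) (hn : 1 ≤ n) :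
    (∃! v, Adj n .apex v) ∧ (∃! u, Adj n u .hub) ∧
    (∀ c r, ∃! v, Adj n (.filled c r) v) ∧ (∀ c r, ∃! u, Adj n u (.hollow c r)) ∧
    (∀ k : Fin (2 * n), (k : ℕ) < n → (∃! v, Adj n (.bdry k) v) ∧ ∀ u, ¬ Adj n u (.bdry k)) ∧
    (∀ k : Fin (2 * n), n ≤ (k : ℕ) → (∃! u, Adj n u (.bdry k)) ∧ ∀ v, ¬ Adj n (.bdry k) v) := by
  refine ⟨?_, ?_, ?_, ?_, ?_, ?_⟩
  · refine ⟨.bdry ⟨n, by omega⟩, ⟨_, _, .apexSink _ ⟨0, by omega⟩ ⟨n - 1, by omega⟩ rfl rfl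
      (by simp only; omega)⟩, ?_⟩
    rintro v ⟨L, R, h⟩
    cases h with
    | apexSink k i j hk hi hj => exact congrArg Vertex.bdry (Fin.ext hk)
  · refine ⟨.bdry ⟨n - 1, by omega⟩, ⟨_, _, .sourceHub _ ⟨n - 1, by omega⟩ ⟨0, by omega⟩
      (by simp only; omega) (by simp only; omega) rfl⟩, ?_⟩
    rintro v ⟨L, R, h⟩
    cases h with
    | sourceHub k i j hk hi hj => exact congrArg Vertex.bdry (Fin.ext (by simp only; omega))
  · intro c r
    refine ⟨.hollow c r, ⟨_, _, .cross c r ⟨c + 1, by omega⟩ ⟨c, by omega⟩ ⟨r + 1, by omega⟩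
      ⟨r, by omega⟩ rfl rfl rfl rfl⟩, ?_⟩
    rintro v ⟨L, R, h⟩
    cases h with
    | cross => rfl
  · intro c r
    refine ⟨.filled c r, ⟨_, _, .cross c r ⟨c + 1, by omega⟩ ⟨c, by omega⟩ ⟨r + 1, by omega⟩
      ⟨r, by omega⟩ rfl rfl rfl rfl⟩, ?_⟩
    rintro v ⟨L, R, h⟩
    cases h with
    | cross => rfl
  · intro k hk
    refine ⟨?_, ?_⟩
    · by_cases hkn : (k : ℕ) + 1 = n
      · refine ⟨.hub, ⟨_, _, .sourceHub _ ⟨n - 1, by omega⟩ ⟨0, by omega⟩ hkn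
          (by simp only; omega) rfl⟩, ?_⟩
        rintro v ⟨L, R, h⟩
        cases h with
        | sourceHub => rfl
        | sourceUp c => omega
      · refine ⟨.filled ⟨k, by omega⟩ ⟨0, by omega⟩, ⟨_, _, .sourceUp _ _ _ ⟨k + 1, by omega⟩
          ⟨k, by omega⟩ ⟨0, by omega⟩ rfl rfl rfl rfl rfl⟩, ?_⟩
        rintro v ⟨L, R, h⟩
        cases h with
        | sourceHub => omega
        | sourceUp c r k iL iR j hr hk' =>
          exact congrArg₂ Vertex.filled (Fin.ext hk'.symm) (Fin.ext hr)
    · rintro u ⟨L, R, h⟩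
      cases h <;> omega
  · intro k hk
    refine ⟨?_, ?_⟩
    · by_cases hkn : (k : ℕ) = n
      · refine ⟨.apex, ⟨_, _, .apexSink _ ⟨0, by omega⟩ ⟨n - 1, by omega⟩ hkn rfl
          (by simp only; omega)⟩, ?_⟩
        rintro v ⟨L, R, h⟩
        cases h with
        | apexSink => rfl
        | rightSink c r => omega
      · have := k.isLt
        refine ⟨.hollow ⟨0, by omega⟩ ⟨2 * n - 1 - k, by omega⟩, ⟨_, _, .rightSink _ _ _
          ⟨0, by omega⟩ ⟨2 * n - 1 - k + 1, by omega⟩ ⟨2 * n - 1 - k, by omega⟩ rfl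
          (by simp only; omega) rfl rfl rfl⟩, ?_⟩
        rintro v ⟨L, R, h⟩
        cases h with
        | apexSink => omega
        | rightSink c r k i jL jR hc hk' =>
          exact congrArg₂ Vertex.hollow (Fin.ext hc) (Fin.ext (by simp only; omega))
    · rintro u ⟨L, R, h⟩
      cases h <;> omega

/-! ### Flows and flow polynomials -/

/-- Vertex sequences without repetition (a finite type). -/
abbrev SimpleSeq (n : ℕ) : Type := {p : List (Vertex n) // p.Nodup}

/-- `p` is a directed path from the boundary vertex `a` to the boundary vertex `b`. -/
def IsPath {n : ℕ} (a b : Fin (2 * n)) (p : SimpleSeq n) : Prop :=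
  p.1.IsChain (Adj n) ∧ p.1.head? = some (.bdry a) ∧ p.1.getLast? = some (.bdry b)

/-- The path `p` uses the edge from `u` to `v`. -/
def Uses {n : ℕ} (p : SimpleSeq n) (u v : Vertex n) : Prop := [u, v] <:+: p.1

/-- Two faces share an edge that does not belong to the path `p`. -/
def FaceStep {n : ℕ} (p : SimpleSeq n) (f g : Face n) : Prop :=
  ∃ u v, ¬ Uses p u v ∧ (Arrow n u v f g ∨ Arrow n u v g f)

/-- The face `f` lies in the part of the disk to the left of the path `p`: it can be reached,
without crossing `p`, from a face that is immediately to the left of an edge of `p`. -/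
def LeftOf {n : ℕ} (p : SimpleSeq n) (f : Face n) : Prop :=
  ∃ u v L R, Uses p u v ∧ Arrow n u v L R ∧ Relation.ReflTransGen (FaceStep p) L f

/-- The boundary vertices `1, …, n`, the sources of the orientation. -/
def sources (n : ℕ) : Finset (Fin (2 * n)) := Finset.univ.filter fun k => (k : ℕ) < n

/-- A flow from `{1, …, n}` to `J`: a collection of pairwise vertex-disjoint paths whose sources are
`{1, …, n} \ J` and whose sinks are `J \ {1, …, n}`. -/
structure IsFlow {n : ℕ} (J : Finset (Fin (2 * n))) (F : Finset (SimpleSeq n)) : Prop where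
  isPath : ∀ p ∈ F, ∃ a ∈ sources n \ J, ∃ b ∈ J \ sources n, IsPath a b p
  source : ∀ a ∈ sources n \ J, ∃ p ∈ F, p.1.head? = some (.bdry a)
  sink : ∀ b ∈ J \ sources n, ∃ p ∈ F, p.1.getLast? = some (.bdry b)
  disjoint : ∀ p ∈ F, ∀ q ∈ F, p ≠ q → List.Disjoint p.1 q.1

open Classical in
/-- The weight of a path: the product of the variables of the faces on its left. -/
noncomputable def pathWeight {n : ℕ} (p : SimpleSeq n) : MvPolynomial (Face n) ℂ :=
  ∏ f ∈ Finset.univ.filter (LeftOf p), MvPolynomial.X f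

open Classical in
/-- The flow polynomial `P_J`, in one variable for each face. -/
noncomputable def flowPoly (n : ℕ) (J : Finset (Fin (2 * n))) : MvPolynomial (Face n) ℂ :=
  ∑ F ∈ Finset.univ.filter (IsFlow J), ∏ p ∈ F, pathWeight p

/-! ### The network torus of `LGr(n, 2n)` and the valuation -/

/-- Faces whose labels are equal or transpose to each other are identified. -/
def faceSetoid (n : ℕ) : Setoid (Face n) where
  r f g := f.label = g.label ∨ f.label = g.label.transpose
  iseqv :=
    { refl := fun _ => Or.inl rfl
      symm := by
        rintro f g (h | h)
        · exact Or.inl h.symm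
        · exact Or.inr (by rw [h, YoungDiagram.transpose_transpose])
      trans := by
        rintro f g k (h | h) (h' | h')
        · exact Or.inl (h.trans h')
        · exact Or.inr (h.trans h')
        · exact Or.inr (by rw [h, h'])
        · exact Or.inl (by rw [h, h', YoungDiagram.transpose_transpose]) }

/-- The coordinates of the network torus of `LGr(n, 2n)`: face labels up to transposition. -/
def Coord (n : ℕ) : Type := Quotient (faceSetoid n)

/-- The coordinate belonging to a face. -/
def Face.coord {n : ℕ} (f : Face n) : Coord n := Quotient.mk (faceSetoid n) f

/-- The coordinate ring of the network torus: Laurent polynomials in the torus coordinates, as the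
group algebra of the lattice of exponent vectors. -/
abbrev TorusRing (n : ℕ) : Type := AddMonoidAlgebra ℂ (Coord n →₀ ℤ)

/-- The Plücker coordinate `p_J` of `LGr(n, 2n)`, as a function on the network torus: the flow
polynomial `P_J` with the variables of faces with transposed labels set equal. -/
noncomputable def pluecker (n : ℕ) (J : Finset (Fin (2 * n))) : TorusRing n :=
  MvPolynomial.aeval
    (fun f : Face n => (AddMonoidAlgebra.single (Finsupp.single f.coord 1) 1 : TorusRing n))
    (flowPoly n J)

open Classical in
/-- The valuation of a Laurent polynomial, for a given total order of the torus coordinates: the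
exponent vector of its lexicographically minimal term. (It is `0` for the zero polynomial, to which
no valuation is assigned.) -/
noncomputable def val {n : ℕ} [LinearOrder (Coord n)] (f : TorusRing n) : Coord n →₀ ℤ :=
  if h : (f.coeff.support.image toLex).Nonempty then
    ofLex ((f.coeff.support.image toLex).min' h)
  else 0

/-! ### The matrix -/

/-- The index pairs `(i, j)`, `0 ≤ i ≤ j ≤ n - 1`, of the columns: they are ordered by increasing
`i`, and for equal `i` by decreasing `j`. -/
def colPairs (n : ℕ) : Finset (ℕ ×ₗ ℕᵒᵈ) :=
  ((Finset.range n ×ˢ Finset.range n).filter fun p => p.1 ≤ p.2).image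
    fun p => toLex (p.1, OrderDual.toDual p.2)

/-- The index pairs `(j, i)` of the rows, where `(j, i)` stands for the diagram `(n^i, j^(n-i))`:
all `(j, i) ≠ (0, 0)` with `j ≤ i ≤ n - 1`, which give the complements of rectangles other than `∅`
and the full square, one in each transposition class; and `(n - 1, n)` for the full square. They are
ordered by increasing `j`, and for equal `j` by increasing `i`. -/
def rowPairs (n : ℕ) : Finset (ℕ ×ₗ ℕ) :=
  ((Finset.range n ×ˢ Finset.range (n + 1)).filter fun p =>
    (p.1 ≤ p.2 ∧ p.2 < n ∧ p ≠ (0, 0)) ∨ (p.1 + 1 = n ∧ p.2 = n)).image toLex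

theorem card_pairs (n : ℕ) :
    ((Finset.range n ×ˢ Finset.range n).filter fun p : ℕ × ℕ => p.1 ≤ p.2).card
      = (n + 1).choose 2 := by
  have h : ((Finset.range n ×ˢ Finset.range n).filter fun p : ℕ × ℕ => p.1 ≤ p.2).card
      = ((Finset.range n).sigma fun j => Finset.range (j + 1)).card := by
    refine Finset.card_bij' (fun p _ => ⟨p.2, p.1⟩) (fun p _ => (p.2, p.1)) ?_ ?_ ?_ ?_
    · simp only [Finset.mem_filter, Finset.mem_product, Finset.mem_sigma, Finset.mem_range]
      omega
    · simp only [Finset.mem_filter, Finset.mem_product, Finset.mem_sigma, Finset.mem_range]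
      omega
    · intros; rfl
    · intros; rfl
  rw [h, Finset.card_sigma]
  simp only [Finset.card_range]
  have h2 := Finset.sum_range_succ' (fun i => i) n
  rw [Finset.sum_range_id, add_zero] at h2
  rw [← h2, Nat.choose_two_right]

theorem card_colPairs (n : ℕ) : (colPairs n).card = (n + 1).choose 2 := by
  rw [colPairs, Finset.card_image_of_injective, card_pairs]
  rintro ⟨a, b⟩ ⟨c, d⟩ h
  have h' := congrArg ofLex h
  simpa using h'

theorem card_rowPairs (n : ℕ) : (rowPairs n).card = (n + 1).choose 2 := by
  rw [rowPairs, Finset.card_image_of_injective _ toLex.injective, ← card_pairs]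
  refine Finset.card_bij' (fun p _ => if p.2 = n then (0, 0) else p)
    (fun p _ => if p = (0, 0) then (n - 1, n) else (p.1, p.2)) ?_ ?_ ?_ ?_
  all_goals
    rintro ⟨a, b⟩ h
    simp only [Finset.mem_filter, Finset.mem_product, Finset.mem_range, Prod.mk.injEq, ne_eq] at h
    simp only [Prod.mk.injEq, Finset.mem_filter, Finset.mem_product, Finset.mem_range, ne_eq]
    split_ifs <;> simp_all <;> omega

/-- The `k`-th column label, a Young diagram. -/
def colDiagram (n : ℕ) (k : Fin ((n + 1).choose 2)) : YoungDiagram :=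
  let p := ofLex ((colPairs n).orderEmbOfFin (card_colPairs n) k)
  nearSquare n p.1 (OrderDual.ofDual p.2)

/-- The face with label `(n^i, j^(n-i))`. -/
def faceOf (n i j : ℕ) : Face n :=
  if h : i < n ∧ j < n then .cell ⟨i, h.1⟩ ⟨j, h.2⟩ else .outer

/-- The `k`-th row label, a torus coordinate. -/
def rowCoord (n : ℕ) (k : Fin ((n + 1).choose 2)) : Coord n :=
  let p := ofLex ((rowPairs n).orderEmbOfFin (card_rowPairs n) k)
  (faceOf n p.2 p.1).coord

/-- The matrix `M_n`; its columns are the valuations of the Plücker coordinates of the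
diagrams `colDiagram n k`. -/
noncomputable def M (n : ℕ) [LinearOrder (Coord n)] :
    Matrix (Fin ((n + 1).choose 2)) (Fin ((n + 1).choose 2)) ℤ :=
  Matrix.of fun r k => val (pluecker n (subsetOf n (colDiagram n k))) (rowCoord n r)

/-! ### Column operations -/

/-- `A` is transformed into `B` by one elementary integral column operation. -/
inductive ColStep {N : ℕ} (A : Matrix (Fin N) (Fin N) ℤ) : Matrix (Fin N) (Fin N) ℤ → Prop
  | add (i j : Fin N) (hij : i ≠ j) (c : ℤ) :
      ColStep A (A.updateCol j fun r => A r j + c * A r i)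
  | swap (i j : Fin N) : ColStep A (A.submatrix id (Equiv.swap i j))
  | neg (j : Fin N) : ColStep A (A.updateCol j fun r => - A r j)

end CoRect

namespace CoRect

/-! ### Reduction of integer matrices by column operations -/

/-! With labels counted from `0`, the subset of the diagram `nearSquare n i j` arises from the
source set by replacing `j` with `2n - 1 - i`. A flow is therefore a single path from source `j` to
sink `2n - 1 - i`, and the Plücker coordinate is a sum over such paths.

Among these paths there is one that hugs the rectangle of faces `InRect i j`: its left side avoids
this rectangle (`exists_isPath`). Conversely, every such path has all faces outside the rectangle on
its left (`IsPath.leftOf`). So the monomial of the hugging path divides all the others. Coefficients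
count paths, so nothing cancels, and this monomial is lexicographically minimal for every order of
the coordinates (`val_pluecker_nearSquare`). Counting the one or two faces that share a coordinate
gives the explicit matrix `entry`.

Differences of columns that are neighbours in `j`, and then of those that are neighbours in `i`,
yield all standard basis vectors (`eq_top_of_entry_mem`). The columns thus generate the whole
lattice and the determinant is a unit. Euclid's algorithm on columns makes any integer matrix lower
triangular. For a unit determinant the diagonal entries are `±1`, and sign changes finish the proof.
-/

theorem natAbs_add_neg_ediv_mul_lt (a : ℤ) {b : ℤ} (hb : b ≠ 0) :
    (a + -(a / b) * b).natAbs < b.natAbs := by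
  have h1 : a + -(a / b) * b = a % b := by
    have := Int.emod_add_mul_ediv a b
    linarith
  rw [h1]
  have h2 := Int.emod_lt_abs a hb
  have h3 := Int.emod_nonneg a hb
  rw [Int.abs_eq_natAbs] at h2
  omega

/-- Column operations that clear row `k` to the right of the diagonal, if the rows above are
already cleared. -/
theorem exists_clear_row {N : ℕ} (A : Matrix (Fin N) (Fin N) ℤ) (k : Fin N)
    (hA : ∀ i j, i < k → i < j → A i j = 0) :
    ∃ B, Relation.ReflTransGen ColStep A B ∧ ∀ i j, i ≤ k → i < j → B i j = 0 := by
  by_cases h : ∀ j, k < j → A k j = 0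
  · refine ⟨A, .refl, fun i j hik hij => ?_⟩
    rcases hik.lt_or_eq with hik | rfl
    · exact hA i j hik hij
    · exact h j hij
  push Not at h
  obtain ⟨j, hkj, hj⟩ := h
  -- Euclid's algorithm on the pivot and `A k j`. The measure is lexicographic: first the sum of the
  -- absolute values to the right of the pivot, then the absolute value of the pivot. A zero pivot
  -- is exchanged with `A k j`, which lowers the sum.
  by_cases h0 : A k k = 0
  · have hdec : ∑ l ∈ Finset.Ioi k, ((A.submatrix id (Equiv.swap k j)) k l).natAbs
        < ∑ l ∈ Finset.Ioi k, (A k l).natAbs := by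
      refine Finset.sum_lt_sum (fun l hl => ?_) ⟨j, Finset.mem_Ioi.2 hkj, ?_⟩
      · rw [Finset.mem_Ioi] at hl
        by_cases hlj : l = j
        · simp [hlj, h0]
        · simp [Equiv.swap_apply_of_ne_of_ne hl.ne' hlj]
      · simpa [h0] using hj
    obtain ⟨B, hAB, hB⟩ := exists_clear_row (A.submatrix id (Equiv.swap k j)) k (by
      intro i l hik hil
      simp only [Matrix.submatrix_apply, id]
      apply hA i _ hik
      rw [Equiv.swap_apply_def]
      split_ifs
      · exact hik.trans hkj
      · exact hik
      · exact hil)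
    exact ⟨B, .head (.swap k j) hAB, hB⟩
  -- The larger of the two entries is replaced by its remainder modulo the other. Reducing `A k j`
  -- lowers the sum; reducing the pivot keeps the sum and lowers the pivot.
  by_cases hle : (A k k).natAbs ≤ (A k j).natAbs
  · have hdec : ∑ l ∈ Finset.Ioi k,
          ((A.updateCol j fun r => A r j + -(A k j / A k k) * A r k) k l).natAbs
        < ∑ l ∈ Finset.Ioi k, (A k l).natAbs := by
      refine Finset.sum_lt_sum (fun l hl => ?_) ⟨j, Finset.mem_Ioi.2 hkj, ?_⟩
      · by_cases hlj : l = j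
        · subst hlj
          simp only [Matrix.updateCol_self]
          exact (natAbs_add_neg_ediv_mul_lt _ h0).le.trans hle
        · simp [Matrix.updateCol_ne hlj]
      · simp only [Matrix.updateCol_self]
        exact (natAbs_add_neg_ediv_mul_lt _ h0).trans_le hle
    obtain ⟨B, hAB, hB⟩ := exists_clear_row
      (A.updateCol j fun r => A r j + -(A k j / A k k) * A r k) k (by
      intro i l hik hil
      by_cases hlj : l = j
      · subst hlj
        simp [hA i l hik hil, hA i k hik hik]
      · rw [Matrix.updateCol_ne hlj, hA i l hik hil])
    exact ⟨B, .head (.add k j hkj.ne _) hAB, hB⟩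
  · have hsum : ∑ l ∈ Finset.Ioi k,
          ((A.updateCol k fun r => A r k + -(A k k / A k j) * A r j) k l).natAbs
        = ∑ l ∈ Finset.Ioi k, (A k l).natAbs := by
      refine Finset.sum_congr rfl fun l hl => ?_
      rw [Matrix.updateCol_ne (Finset.mem_Ioi.1 hl).ne']
    have hdec : ((A.updateCol k fun r => A r k + -(A k k / A k j) * A r j) k k).natAbs
        < (A k k).natAbs := by
      simp only [Matrix.updateCol_self]
      exact (natAbs_add_neg_ediv_mul_lt _ hj).trans (not_le.1 hle)
    obtain ⟨B, hAB, hB⟩ := exists_clear_row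
      (A.updateCol k fun r => A r k + -(A k k / A k j) * A r j) k (by
      intro i l hik hil
      by_cases hlk : l = k
      · subst hlk
        simp [hA i l hik hil, hA i j hik (hik.trans hkj)]
      · rw [Matrix.updateCol_ne hlk, hA i l hik hil])
    exact ⟨B, .head (.add j k hkj.ne' _) hAB, hB⟩
termination_by (∑ l ∈ Finset.Ioi k, (A k l).natAbs, (A k k).natAbs)
decreasing_by
  · exact Prod.Lex.left _ _ hdec
  · exact Prod.Lex.left _ _ hdec
  · rw [hsum]
    exact Prod.Lex.right _ hdec

theorem exists_lowerTriangular {N : ℕ} (A : Matrix (Fin N) (Fin N) ℤ) :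
    ∃ B, Relation.ReflTransGen ColStep A B ∧ ∀ i j, i < j → B i j = 0 := by
  have key : ∀ m ≤ N, ∃ B, Relation.ReflTransGen ColStep A B ∧
      ∀ i j : Fin N, (i : ℕ) < m → i < j → B i j = 0 := by
    intro m
    induction m with
    | zero => exact fun _ => ⟨A, .refl, fun i j h => absurd h (Nat.not_lt_zero _)⟩
    | succ m ih =>
      intro hm
      obtain ⟨B, hAB, hB⟩ := ih (by omega)
      obtain ⟨C, hBC, hC⟩ := exists_clear_row B ⟨m, hm⟩ fun i j hi => hB i j hi
      exact ⟨C, hAB.trans hBC, fun i j hi => hC i j (Nat.lt_succ_iff.1 hi)⟩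
  obtain ⟨B, hAB, hB⟩ := key N le_rfl
  exact ⟨B, hAB, fun i j => hB i j i.isLt⟩

theorem ColStep.isUnit_det {N : ℕ} {A B : Matrix (Fin N) (Fin N) ℤ} (h : ColStep A B)
    (hA : IsUnit A.det) : IsUnit B.det := by
  cases h with
  | add i j hij c =>
    have := Matrix.det_updateCol_add_smul_self A hij.symm c
    simp only [smul_eq_mul] at this
    rwa [this]
  | swap i j =>
    rw [Matrix.det_permute']
    exact (Units.isUnit _).map (Int.castRingHom ℤ) |>.mul hA
  | neg j =>
    have := Matrix.det_updateCol_smul A j (-1) fun r => A r j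
    have h2 : ((-1 : ℤ) • fun r => A r j) = fun r => - A r j := by
      ext r; simp
    rw [h2] at this
    rw [this, Matrix.updateCol_eq_self]
    simpa using hA

/-- An integer matrix of determinant `±1` can be made lower unitriangular by column operations. -/
theorem exists_lower_unitriangular {N : ℕ} (A : Matrix (Fin N) (Fin N) ℤ) (hA : IsUnit A.det) :
    ∃ B, Relation.ReflTransGen ColStep A B ∧ (∀ i j, i < j → B i j = 0) ∧ ∀ i, B i i = 1 := by
  obtain ⟨B, hAB, hB⟩ := exists_lowerTriangular A
  have hdet : IsUnit B.det := by
    clear hB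
    induction hAB with
    | refl => exact hA
    | tail _ h ih => exact h.isUnit_det ih
  -- The determinant is the product of the diagonal entries, so each of them is a unit of `ℤ`.
  -- Negating a column keeps the triangular shape, so the signs can be corrected one at a time.
  rw [Matrix.det_of_isLowerTriangular B (fun i j h => hB i j h), IsUnit.prod_univ_iff] at hdet
  have key : ∀ s : Finset (Fin N), ∃ C, Relation.ReflTransGen ColStep A C ∧
      (∀ i j, i < j → C i j = 0) ∧ (∀ i, IsUnit (C i i)) ∧ ∀ i ∈ s, C i i = 1 := by
    intro s
    induction s using Finset.induction_on with
    | empty => exact ⟨B, hAB, hB, hdet, by simp⟩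
    | insert k s hk ih =>
      obtain ⟨C, hAC, hC, hu, hs⟩ := ih
      rcases Int.isUnit_iff.1 (hu k) with h | h
      · refine ⟨C, hAC, hC, hu, fun i hi => ?_⟩
        rcases Finset.mem_insert.1 hi with rfl | hi
        · exact h
        · exact hs i hi
      · refine ⟨_, hAC.tail (.neg k), fun i j hij => ?_, fun i => ?_, fun i hi => ?_⟩
        · by_cases hj : j = k
          · subst hj; simp [hC i j hij]
          · rw [Matrix.updateCol_ne hj, hC i j hij]
        · by_cases hj : i = k
          · subst hj; simp [h]
          · rw [Matrix.updateCol_ne hj]; exact hu i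
        · by_cases hj : i = k
          · subst hj; simp [h]
          · rw [Matrix.updateCol_ne hj]
            exact hs i ((Finset.mem_insert.1 hi).resolve_left hj)
  obtain ⟨C, hAC, hC, -, h1⟩ := key Finset.univ
  exact ⟨C, hAC, hC, fun i => h1 i (Finset.mem_univ i)⟩

variable {n : ℕ}

/-! ### Paths and the faces on their left -/

/-- The faces to the right of the path that runs up the vertical strand `j` and then along the
horizontal strand `i`. -/
def InRect (i j : ℕ) : Face n → Prop
  | .outer => False
  | .cell a b => (a : ℕ) ≤ j ∧ (b : ℕ) ≤ i

/-- A height function on the vertices which increases along all edges. -/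
def rank : Vertex n → ℕ
  | .bdry k => if (k : ℕ) < n then 0 else 4 * n + 1
  | .hub => 1
  | .filled c r => 2 + 2 * ((n - 2 - c) + r)
  | .hollow c r => 3 + 2 * ((n - 2 - c) + r)
  | .apex => 4 * n

/-- Vertical strands are numbered from right to left, so `n - 2 - c` grows along horizontal strands
just as `r` grows along vertical ones; the factor 2 leaves room for both vertices of a crossing. In
particular the orientation is acyclic. -/
theorem rank_lt {u v : Vertex n} (h : Adj n u v) : rank u < rank v := by
  obtain ⟨L, R, h⟩ := h
  cases h <;> simp only [rank] <;> (try split_ifs) <;> omega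

theorem nodup_of_isChain {p : List (Vertex n)} (h : p.IsChain (Adj n)) : p.Nodup := by
  have h1 : p.IsChain (fun u v => rank u < rank v) := h.imp fun _ _ => rank_lt
  exact (List.isChain_map rank).2 h1 |>.pairwise.imp ne_of_lt |>.of_map rank
    fun _ _ h => by rintro rfl; exact h rfl

theorem arrow_faces_eq {u v : Vertex n} {L R L' R' : Face n} (h : Arrow n u v L R)
    (h' : Arrow n u v L' R') : L = L' ∧ R = R' := by
  cases h <;> cases h' <;> simp only [Face.cell.injEq, Fin.ext_iff, true_and] <;> omega

/-- The edge from `u` to `v` separates the faces in `InRect i j` on its right from the others. -/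
def Sep (i j : ℕ) (u v : Vertex n) : Prop :=
  ∃ L R, Arrow n u v L R ∧ ¬ InRect i j L ∧ InRect i j R

theorem Sep.adj {i j : ℕ} {u v : Vertex n} (h : Sep i j u v) : Adj n u v := by
  obtain ⟨L, R, h, -⟩ := h
  exact ⟨L, R, h⟩

/-- Edges run upwards or to the right, so crossing one from left to right never increases the
indices of a face. Hence the rectangle can be entered only from left to right. -/
theorem inRect_right_of_left {i j : ℕ} {u v : Vertex n} {L R : Face n} (h : Arrow n u v L R)
    (hL : InRect i j L) : InRect i j R := by
  cases h <;> simp only [InRect] at * <;> omega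

/-- Separating edges are ordered linearly by height. -/
theorem Sep.rank_le_or_eq {i j : ℕ} {u v x y : Vertex n} (h : Sep i j u v) (h' : Sep i j x y)
    (hr : rank y ≤ rank v) : rank y ≤ rank u ∨ (x = u ∧ y = v) := by
  obtain ⟨L, R, h, h1, h2⟩ := h
  obtain ⟨L', R', h', h3, h4⟩ := h'
  cases h <;> cases h' <;>
    simp only [InRect, rank, Vertex.bdry.injEq, Vertex.filled.injEq, Vertex.hollow.injEq,
      Fin.ext_iff, reduceCtorEq, false_and, and_false, or_false, true_and, and_true, and_self,
      or_true] at * <;>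
    (try split_ifs at *) <;> omega

/-- There is a path of separating edges from the boundary vertex `k` to `v` which uses all those of
them that end at most at the height of `v`. -/
def SepPath (i j : ℕ) (k : Fin (2 * n)) (v : Vertex n) : Prop :=
  ∃ p : List (Vertex n), p.IsChain (Sep i j) ∧ p.head? = some (.bdry k) ∧ p.getLast? = some v ∧
    ∀ x y, Sep i j x y → rank y ≤ rank v → [x, y] <:+: p

theorem SepPath.step {i j : ℕ} {k : Fin (2 * n)} {v w : Vertex n} (h : SepPath i j k v)
    (hw : Sep i j v w) : SepPath i j k w := by
  obtain ⟨p, hc, hh, hl, hu⟩ := h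
  refine ⟨p ++ [w], ?_, ?_, by simp, fun x y hxy hr => ?_⟩
  · rw [List.isChain_append]
    refine ⟨hc, .singleton _, ?_⟩
    rw [hl]
    simpa using hw
  · rw [List.head?_append, hh]; rfl
  -- A separating edge ending no higher than `w` either ends no higher than `v`, and is already in
  -- the path, or is the new edge itself.
  · rcases hw.rank_le_or_eq hxy hr with h | ⟨rfl, rfl⟩
    · exact (hu x y hxy h).trans (List.prefix_append _ _).isInfix
    · obtain ⟨q, rfl⟩ := List.getLast?_eq_some_iff.1 hl
      exact ⟨q, [], by simp⟩

theorem SepPath.start (i : ℕ) {j : ℕ} (k : Fin (2 * n)) (hk : (k : ℕ) < n) :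
    SepPath i j k (.bdry k) := by
  refine ⟨[.bdry k], .singleton _, rfl, rfl, fun x y h hr => ?_⟩
  have := rank_lt h.adj
  have : rank (.bdry k : Vertex n) = 0 := if_pos hk
  omega

theorem SepPath.up {i j : ℕ} (hi : i < n) (hj : j + 1 < n) (k : Fin (2 * n)) (hk : (k : ℕ) = j)
    (r : ℕ) (hr : r ≤ i) (hrn : r < n - 1) :
    SepPath i j k (.hollow ⟨j, by omega⟩ ⟨r, hrn⟩ : Vertex n) := by
  have cross : ∀ r (hr : r ≤ i) (hrn : r < n - 1),
      Sep i j (.filled ⟨j, by omega⟩ ⟨r, hrn⟩ : Vertex n) (.hollow ⟨j, by omega⟩ ⟨r, hrn⟩) :=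
    fun r hr hrn => ⟨_, _, .cross _ _ ⟨j + 1, by omega⟩ ⟨j, by omega⟩ ⟨r + 1, by omega⟩
      ⟨r, by omega⟩ rfl rfl rfl rfl, by simp [InRect], by simpa [InRect] using hr⟩
  induction r with
  | zero =>
    refine .step (v := .filled ⟨j, by omega⟩ ⟨0, hrn⟩) (.step (.start i k (by omega)) ?_)
      (cross 0 hr hrn)
    exact ⟨_, _, .sourceUp _ _ k ⟨j + 1, by omega⟩ ⟨j, by omega⟩ ⟨0, by omega⟩ rfl hk rfl rfl rfl,
      by simp [InRect], by simp [InRect]⟩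
  | succ r ih =>
    refine .step (.step (ih (by omega) (by omega) cross) ?_) (cross (r + 1) hr hrn)
    exact ⟨_, _, .up _ _ _ ⟨j + 1, by omega⟩ ⟨j, by omega⟩ ⟨r + 1, by omega⟩ rfl rfl rfl rfl,
      by simp [InRect], by simpa [InRect] using hr⟩

theorem SepPath.right {i j : ℕ} (hi : i + 1 < n) (hj : j < n) (k : Fin (2 * n)) (hk : (k : ℕ) = j)
    (c : ℕ) (hc : c ≤ j) (hcn : c < n - 1) :
    SepPath i j k (.hollow ⟨c, hcn⟩ ⟨i, by omega⟩ : Vertex n) := by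
  have cross : ∀ c (hc : c ≤ j) (hcn : c < n - 1),
      Sep i j (.filled ⟨c, hcn⟩ ⟨i, by omega⟩ : Vertex n) (.hollow ⟨c, hcn⟩ ⟨i, by omega⟩) :=
    fun c hc hcn => ⟨_, _, .cross _ _ ⟨c + 1, by omega⟩ ⟨c, by omega⟩ ⟨i + 1, by omega⟩
      ⟨i, by omega⟩ rfl rfl rfl rfl, by simp [InRect], by simpa [InRect] using hc⟩
  by_cases hcj : c = j
  · subst hcj
    exact .up (by omega) (by omega) k hk i le_rfl (by omega)
  -- As `c < j`, this is the case `j = n - 1`: there is no vertical strand `j`, and the path enters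
  -- the horizontal strand from the hub.
  by_cases hcn' : c + 2 = n
  · refine .step (v := .filled ⟨c, hcn⟩ ⟨i, by omega⟩) (.step (v := .hub)
      (.step (.start i k (by omega)) ?_) ?_) (cross c hc hcn)
    · exact ⟨_, _, .sourceHub k ⟨j, by omega⟩ ⟨0, by omega⟩ (by omega) (by simp only; omega) rfl,
        by simp [InRect], by simp [InRect]⟩
    · exact ⟨_, _, .hubRight _ _ ⟨j, by omega⟩ ⟨i + 1, by omega⟩ ⟨i, by omega⟩ (by simp only; omega)
        (by simp only; omega) rfl rfl, by simp [InRect], by simp [InRect]⟩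
  · refine .step (.step (SepPath.right hi hj k hk (c + 1) (by omega) (by omega)) ?_)
      (cross c hc hcn)
    exact ⟨_, _, .right _ _ _ ⟨c + 1, by omega⟩ ⟨i + 1, by omega⟩ ⟨i, by omega⟩ rfl rfl rfl rfl,
      by simp [InRect], by simp [InRect]; omega⟩
termination_by n - c

/-- There is no horizontal strand `n - 1`; for `i = n - 1` the path leaves through the apex instead.
-/
theorem SepPath.apex {j : ℕ} (hj : j < n) (k : Fin (2 * n)) (hk : (k : ℕ) = j) :
    SepPath (n - 1) j k (.apex : Vertex n) := by
  by_cases hjn : j + 1 = n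
  · refine .step (v := .hub) (.step (.start _ k (by omega)) ?_) ?_
    · exact ⟨_, _, .sourceHub k ⟨j, by omega⟩ ⟨0, by omega⟩ (by omega) hjn rfl,
        by simp [InRect], by simp [InRect]⟩
    · exact ⟨_, _, .hubApex ⟨j, by omega⟩ hjn, by simp [InRect], by simp [InRect]; omega⟩
  · refine .step (SepPath.up (by omega) (by omega) k hk (n - 2) (by omega) (by omega)) ?_
    exact ⟨_, _, .upApex _ _ ⟨j + 1, by omega⟩ ⟨j, by omega⟩ ⟨n - 1, by omega⟩ (by simp only; omega)
      rfl rfl (by simp only; omega), by simp [InRect], by simp [InRect]⟩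

theorem SepPath.sink {i j : ℕ} (hi : i < n) (hj : j < n) (k l : Fin (2 * n)) (hk : (k : ℕ) = j)
    (hl : (l : ℕ) + 1 + i = 2 * n) : SepPath i j k (.bdry l : Vertex n) := by
  by_cases hin : i + 1 = n
  · obtain rfl : i = n - 1 := by omega
    refine .step (.apex hj k hk) ?_
    exact ⟨_, _, .apexSink l ⟨0, by omega⟩ ⟨n - 1, by omega⟩ (by omega) rfl hin, by simp [InRect],
      by simp [InRect]⟩
  · refine .step (.right (by omega) hj k hk 0 (by omega) (by omega)) ?_
    exact ⟨_, _, .rightSink _ _ l ⟨0, by omega⟩ ⟨i + 1, by omega⟩ ⟨i, by omega⟩ rfl hl rfl rfl rfl,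
      by simp [InRect], by simp [InRect]⟩

/-- There is a path from `j` to `2 * n - 1 - i` such that only the faces outside `InRect i j` are on
its left. -/
theorem exists_isPath {i j : ℕ} (hi : i < n) (hj : j < n) (k l : Fin (2 * n)) (hk : (k : ℕ) = j)
    (hl : (l : ℕ) + 1 + i = 2 * n) :
    ∃ p : SimpleSeq n, IsPath k l p ∧ ∀ f, LeftOf p f → ¬ InRect i j f := by
  obtain ⟨p, hc, hh, hlast, hu⟩ := SepPath.sink hi hj k l hk hl
  have hc' : p.IsChain (Adj n) := hc.imp fun _ _ => Sep.adj
  refine ⟨⟨p, nodup_of_isChain hc'⟩, ⟨hc', hh, hlast⟩, ?_⟩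
  -- A sink has maximal height, so the path uses every separating edge.
  have hu : ∀ x y, Sep i j x y → [x, y] <:+: p := fun x y hxy => hu x y hxy (by
    have hr : ∀ v : Vertex n, rank v ≤ 4 * n + 1 := by
      rintro (k | _ | _ | _ | _) <;> simp only [rank] <;> (try split_ifs) <;> omega
    refine (hr y).trans_eq ?_
    simp only [rank]
    rw [if_neg (by omega)])
  rintro f ⟨u, v, L, R, huse, harr, hreach⟩
  have hsep : Sep i j u v := by simpa using hc.infix huse
  obtain ⟨L', R', harr', hL, hR⟩ := hsep
  rw [← (arrow_faces_eq harr harr').1] at hL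
  induction hreach with
  | refl => exact hL
  | tail _ hstep ih =>
    -- A step into the rectangle from left to right would cross a separating edge, which lies on the
    -- path; from right to left it is impossible.
    obtain ⟨x, y, hnot, h | h⟩ := hstep
    · exact fun hin => hnot (hu x y ⟨_, _, h, ih, hin⟩)
    · exact fun hin => ih (inRect_right_of_left h hin)

/-- The vertices that can be reached from the source `j`. -/
def Fwd (j : ℕ) : Vertex n → Prop
  | .bdry m => (m : ℕ) = j ∨ n ≤ (m : ℕ)
  | .hub => j + 1 = n
  | .apex => True
  | .filled c _ => (c : ℕ) ≤ j
  | .hollow c _ => (c : ℕ) ≤ j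

/-- The vertices from which the sink `2 * n - 1 - i` can be reached. -/
def Bwd (i : ℕ) : Vertex n → Prop
  | .bdry m => (m : ℕ) < n ∨ (m : ℕ) + 1 + i = 2 * n
  | .hub => True
  | .apex => i + 1 = n
  | .filled _ r => (r : ℕ) ≤ i
  | .hollow _ r => (r : ℕ) ≤ i

theorem Fwd.of_adj {j : ℕ} {u v : Vertex n} (h : Adj n u v) (hu : Fwd j u) : Fwd j v := by
  obtain ⟨L, R, h⟩ := h
  cases h <;> simp only [Fwd] at * <;> omega

theorem Bwd.of_adj {i : ℕ} {u v : Vertex n} (h : Adj n u v) (hv : Bwd i v) : Bwd i u := by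
  obtain ⟨L, R, h⟩ := h
  cases h <;> simp only [Bwd] at * <;> omega

section

variable {i j : ℕ} {k l : Fin (2 * n)} {p : SimpleSeq n}

theorem IsPath.fwd (h : IsPath k l p) {v : Vertex n} (hv : v ∈ p.1) : Fwd (k : ℕ) v := by
  refine h.1.induction (Fwd (k : ℕ)) _ (fun _ _ => Fwd.of_adj) (fun hne => ?_) v hv
  rw [List.head_of_mem_head? h.2.1]
  exact Or.inl rfl

theorem IsPath.bwd (h : IsPath k l p) (hl : (l : ℕ) + 1 + i = 2 * n) {v : Vertex n}
    (hv : v ∈ p.1) : Bwd i v := by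
  refine h.1.backwards_induction (Bwd i) _ (fun _ _ => Bwd.of_adj) (fun hne => ?_) v hv
  rw [List.getLast_of_mem_getLast? h.2.2]
  exact Or.inr hl

theorem LeftOf.step {f g : Face n} (h : LeftOf p f) (hs : FaceStep p f g) : LeftOf p g := by
  obtain ⟨u, v, L, R, h1, h2, h3⟩ := h
  exact ⟨u, v, L, R, h1, h2, h3.tail hs⟩

theorem faceStep_of_notMem {f g : Face n} {u v : Vertex n} (h : u ∉ p.1 ∨ v ∉ p.1)
    (ha : Arrow n u v f g ∨ Arrow n u v g f) : FaceStep p f g := by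
  refine ⟨u, v, fun hu => ?_, ha⟩
  have := hu.subset
  simp only [List.cons_subset, List.nil_subset, and_true] at this
  tauto

/-- The face on the left of the first edge of a path is on its left. -/
theorem IsPath.leftOf_first (h : IsPath k l p) (hkl : k ≠ l) :
    ∃ v L R, Arrow n (.bdry k) v L R ∧ LeftOf p L := by
  obtain ⟨q, hq⟩ := p
  obtain ⟨hc, hh, hl⟩ := h
  match q with
  | [] => simp at hh
  | [u] =>
    simp only [List.head?_cons, List.getLast?_singleton, Option.some.injEq] at hh hl
    exact absurd (Vertex.bdry.inj (hh.symm.trans hl)) hkl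
  | u :: v :: t =>
    simp only [List.head?_cons, Option.some.injEq] at hh
    subst hh
    obtain ⟨L, R, ha⟩ := (List.isChain_cons_cons.1 hc).1
    exact ⟨v, L, R, ha, _, _, L, R, ⟨[], t, rfl⟩, ha, .refl⟩

/-- Adjacent bottom faces are separated by the edge out of a source, and a path from `k` meets no
other source. -/
theorem IsPath.leftOf_bottom_of (h : IsPath k l p) {a : ℕ} (ha : (k : ℕ) < a) (han : a < n)
    (hleft : LeftOf p (.cell ⟨a, han⟩ ⟨0, by omega⟩)) (b : ℕ) (hab : a ≤ b) (hb : b < n) :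
    LeftOf p (.cell ⟨b, hb⟩ ⟨0, by omega⟩) := by
  induction b, hab using Nat.le_induction with
  | base => exact hleft
  | succ b hab ih =>
    refine (ih (by omega)).step (faceStep_of_notMem (u := .bdry ⟨b, by omega⟩)
      (.inl fun hm => ?_) (.inr (.sourceUp ⟨b, by omega⟩ ⟨0, by omega⟩ ⟨b, by omega⟩ _ _ _
      rfl rfl rfl rfl rfl)))
    have := h.fwd hm
    simp only [Fwd] at this
    omega

theorem IsPath.leftOf_outer_and_bottom (h : IsPath k l p) (hk : (k : ℕ) < n) (hl : n ≤ (l : ℕ)) :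
    LeftOf p .outer ∧ ∀ b (hb : b < n), (k : ℕ) < b →
      LeftOf p (.cell ⟨b, hb⟩ ⟨0, by omega⟩) := by
  obtain ⟨v, L, R, ha, hL⟩ := h.leftOf_first (by rintro rfl; omega)
  cases ha with
  -- Here `k = n - 1`: the face left of the first edge is already the outer one, and no bottom face
  -- remains.
  | sourceHub => exact ⟨hL, fun b hb hkb => by omega⟩
  | sourceUp c r _ iL iR m hr hk' h1 h2 h3 =>
    have hkn : (k : ℕ) + 1 < n := by omega
    obtain rfl : iL = ⟨k + 1, hkn⟩ := Fin.ext (by simp only; omega)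
    have hn : 0 < n := by omega
    obtain rfl : m = ⟨0, hn⟩ := Fin.ext h3
    have key := h.leftOf_bottom_of (Nat.lt_succ_self k) (by omega) hL
    refine ⟨?_, fun b hb hkb => key b (by omega) hb⟩
    refine (key (n - 1) (by omega) (by omega)).step
      (faceStep_of_notMem (u := .bdry ⟨n - 1, by omega⟩) (.inl fun hm => ?_)
      (.inr (.sourceHub _ _ _ (by simp only; omega) (by simp only; omega) rfl)))
    have := h.fwd hm
    simp only [Fwd] at this
    omega

/-- Climb the column `a` from its bottom face. The horizontal edges crossed start at vertices to the
left of everything reachable from `k`. -/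
theorem IsPath.leftOf_of_lt_left (h : IsPath k l p) (hk : (k : ℕ) < n) (hl : n ≤ (l : ℕ))
    {a : ℕ} (ha : a < n) (hka : (k : ℕ) < a) (b : ℕ) (hb : b < n) :
    LeftOf p (.cell ⟨a, ha⟩ ⟨b, hb⟩) := by
  induction b with
  | zero => exact (h.leftOf_outer_and_bottom hk hl).2 a ha hka
  | succ b ih =>
    by_cases han : a + 1 = n
    · refine (ih (by omega)).step (faceStep_of_notMem (u := .hub) (.inl fun hm => ?_)
        (.inr (.hubRight ⟨n - 2, by omega⟩ ⟨b, by omega⟩ _ _ _ (by simp only; omega) han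
          rfl rfl)))
      have := h.fwd hm
      simp only [Fwd] at this
      omega
    · by_cases ha0 : a = 0
      · omega
      refine (ih (by omega)).step (faceStep_of_notMem (u := .hollow ⟨a, by omega⟩ ⟨b, by omega⟩)
        (.inl fun hm => ?_) (.inr (.right _ ⟨a - 1, by omega⟩ _ _ _ _ (by simp only; omega) rfl
          rfl rfl)))
      have := h.fwd hm
      simp only [Fwd] at this
      omega

/-- Descend from the outer face along the right border, crossing only edges into sinks other than
`l`. -/
theorem IsPath.leftOf_right_column (h : IsPath k l p) (hl : (l : ℕ) + 1 + i = 2 * n)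
    (ho : LeftOf p .outer) {b : ℕ} (hib : i < b) (hb : b < n) :
    LeftOf p (.cell ⟨0, by omega⟩ ⟨b, hb⟩) := by
  by_cases hbn : b + 1 = n
  · refine ho.step (faceStep_of_notMem (v := .bdry ⟨n, by omega⟩) (.inr fun hm => ?_)
      (.inl (.apexSink _ _ _ rfl rfl hbn)))
    have := h.bwd hl hm
    simp only [Bwd] at this
    omega
  · refine (h.leftOf_right_column hl ho (b := b + 1) (by omega) (by omega)).step
      (faceStep_of_notMem (v := .bdry ⟨2 * n - 1 - b, by omega⟩) (.inr fun hm => ?_)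
      (.inl (.rightSink ⟨0, by omega⟩ ⟨b, by omega⟩ _ _ _ _ rfl (by simp only; omega) rfl rfl
        rfl)))
    have := h.bwd hl hm
    simp only [Bwd] at this
    omega
termination_by n - b

/-- Move left along the row `b`. The vertical edges crossed end at vertices from which the sink is
out of reach. -/
theorem IsPath.leftOf_of_lt_below (h : IsPath k l p) (hl : (l : ℕ) + 1 + i = 2 * n)
    (ho : LeftOf p .outer) {b : ℕ} (hib : i < b) (hb : b < n) (a : ℕ) (ha : a < n) :
    LeftOf p (.cell ⟨a, ha⟩ ⟨b, hb⟩) := by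
  induction a with
  | zero => exact h.leftOf_right_column hl ho hib hb
  | succ a ih =>
    by_cases hbn : b + 1 = n
    · refine (ih (by omega)).step (faceStep_of_notMem (v := .apex) (.inr fun hm => ?_)
        (.inr (.upApex ⟨a, by omega⟩ ⟨n - 2, by omega⟩ _ _ _ (by simp only; omega) rfl rfl hbn)))
      have := h.bwd hl hm
      simp only [Bwd] at this
      omega
    · refine (ih (by omega)).step (faceStep_of_notMem (v := .filled ⟨a, by omega⟩ ⟨b, by omega⟩)
        (.inr fun hm => ?_) (.inr (.up _ ⟨b - 1, by omega⟩ _ _ _ _ (by simp only; omega) rfl rfl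
          (by simp only; omega))))
      have := h.bwd hl hm
      simp only [Bwd] at this
      omega

/-- All faces outside `InRect i j` are on the left of any path from `j` to `2 * n - 1 - i`. -/
theorem IsPath.leftOf (h : IsPath k l p) (hk : (k : ℕ) = j) (hj : j < n) (hi : i < n)
    (hl : (l : ℕ) + 1 + i = 2 * n) {f : Face n} (hf : ¬ InRect i j f) : LeftOf p f := by
  subst hk
  have ho := (h.leftOf_outer_and_bottom hj (by omega)).1
  match f with
  | .outer => exact ho
  | .cell a b =>
    by_cases hka : (k : ℕ) < a
    · exact h.leftOf_of_lt_left hj (by omega) a.isLt hka b b.isLt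
    · exact h.leftOf_of_lt_below hl ho (by simp only [InRect] at hf; omega) b.isLt a a.isLt

end

/-! ### Flows to the subsets of near squares are single paths -/

theorem rowLen_nearSquare {i j r : ℕ} (hi : i < n) (hj : j < n) (hr : r < n) :
    (nearSquare n i j).rowLen r = if r < j then n else if r + 1 < n then n - 1 else i := by
  have h : ∀ c, c < (nearSquare n i j).rowLen r ↔
      c < n ∧ ((r < n - 1 ∧ c < n - 1) ∨ r < j ∨ c < i) := by
    intro c
    rw [← YoungDiagram.mem_iff_lt_rowLen, ← YoungDiagram.mem_cells]
    simp [nearSquare, hr]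
  generalize (nearSquare n i j).rowLen r = x at h
  refine le_antisymm (le_of_not_gt fun hlt => ?_) (le_of_not_gt fun hlt => ?_)
  · have := (h _).1 hlt
    split_ifs at this <;> omega
  · have := mt (h x).2 (lt_irrefl x)
    split_ifs at hlt <;> omega

theorem mem_subsetOf_nearSquare {i j : ℕ} (hi : i < n) (hj : j < n) (k : Fin (2 * n)) :
    k ∈ subsetOf n (nearSquare n i j) ↔
      ((k : ℕ) < n ∧ (k : ℕ) ≠ j) ∨ (k : ℕ) + 1 + i = 2 * n := by
  simp only [subsetOf, Finset.mem_image, Finset.mem_univ, true_and, Fin.ext_iff]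
  constructor
  · rintro ⟨r, hr⟩
    have hr' := r.isLt
    rw [rowLen_nearSquare hi hj r.isLt] at hr
    split_ifs at hr <;> omega
  · intro h
    -- The vertical step in row `r` is labelled `r` for `r < j`, `r + 1` for `j ≤ r < n - 1`, and
    -- `2n - 1 - i` in the last row; this inverts the labelling.
    refine ⟨⟨if (k : ℕ) < j then k else if (k : ℕ) < n then k - 1 else n - 1, ?_⟩, ?_⟩
    · split_ifs <;> omega
    · rw [rowLen_nearSquare hi hj (by split_ifs <;> omega)]
      simp only
      split_ifs <;> omega

theorem sources_sdiff {i j : ℕ} (hi : i < n) (hj : j < n) (k : Fin (2 * n)) :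
    k ∈ sources n \ subsetOf n (nearSquare n i j) ↔ (k : ℕ) = j := by
  simp only [Finset.mem_sdiff, mem_subsetOf_nearSquare hi hj, sources, Finset.mem_filter,
    Finset.mem_univ, true_and]
  omega

theorem sinks_sdiff {i j : ℕ} (hi : i < n) (hj : j < n) (k : Fin (2 * n)) :
    k ∈ subsetOf n (nearSquare n i j) \ sources n ↔ (k : ℕ) + 1 + i = 2 * n := by
  simp only [Finset.mem_sdiff, mem_subsetOf_nearSquare hi hj, sources, Finset.mem_filter,
    Finset.mem_univ, true_and]
  omega

theorem isFlow_nearSquare_iff {i j : ℕ} (hi : i < n) (hj : j < n) (k l : Fin (2 * n))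
    (hk : (k : ℕ) = j) (hl : (l : ℕ) + 1 + i = 2 * n) (F : Finset (SimpleSeq n)) :
    IsFlow (subsetOf n (nearSquare n i j)) F ↔ ∃ p, IsPath k l p ∧ F = {p} := by
  constructor
  · intro h
    have hpath : ∀ p ∈ F, IsPath k l p := by
      intro p hp
      obtain ⟨a, ha, b, hb, h⟩ := h.isPath p hp
      rw [sources_sdiff hi hj] at ha
      rw [sinks_sdiff hi hj] at hb
      obtain rfl : a = k := Fin.ext (by omega)
      obtain rfl : b = l := Fin.ext (by omega)
      exact h
    obtain ⟨p, hp, -⟩ := h.source k ((sources_sdiff hi hj k).2 hk)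
    refine ⟨p, hpath p hp, Finset.eq_singleton_iff_unique_mem.2 ⟨hp, fun q hq => ?_⟩⟩
    -- Two distinct paths of the flow would share the vertex `k`.
    by_contra hne
    exact h.disjoint q hq p hp hne (List.mem_of_mem_head? (hpath q hq).2.1)
      (List.mem_of_mem_head? (hpath p hp).2.1)
  · rintro ⟨p, hp, rfl⟩
    refine ⟨fun q hq => ?_, fun a ha => ?_, fun b hb => ?_, fun q hq r hr hne => ?_⟩
    · rw [Finset.mem_singleton.1 hq]
      exact ⟨k, (sources_sdiff hi hj k).2 hk, l, (sinks_sdiff hi hj l).2 hl, hp⟩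
    · rw [sources_sdiff hi hj] at ha
      obtain rfl : a = k := Fin.ext (by omega)
      exact ⟨p, by simp, hp.2.1⟩
    · rw [sinks_sdiff hi hj] at hb
      obtain rfl : b = l := Fin.ext (by omega)
      exact ⟨p, by simp, hp.2.2⟩
    · rw [Finset.mem_singleton] at hq hr
      exact absurd (hq.trans hr.symm) hne

open Classical in
theorem flowPoly_nearSquare {i j : ℕ} (hi : i < n) (hj : j < n) (k l : Fin (2 * n))
    (hk : (k : ℕ) = j) (hl : (l : ℕ) + 1 + i = 2 * n) :
    flowPoly n (subsetOf n (nearSquare n i j))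
      = ∑ p ∈ Finset.univ.filter (IsPath k l), pathWeight p := by
  have h : Finset.univ.filter (IsFlow (subsetOf n (nearSquare n i j)))
      = (Finset.univ.filter (IsPath k l)).map ⟨_, Finset.singleton_injective⟩ := by
    ext F
    simp only [Finset.mem_filter, Finset.mem_univ, true_and, Finset.mem_map,
      isFlow_nearSquare_iff hi hj k l hk hl, Function.Embedding.coeFn_mk, eq_comm]
  rw [flowPoly, h, Finset.sum_map]
  simp

/-! ### The valuation of the Plücker coordinates of near squares -/

open Classical in
/-- A sum of monomials whose exponents are all above one of them has this exponent as valuation. -/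
theorem val_sum_single [LinearOrder (Coord n)] {ι : Type*} (s : Finset ι)
    (e : ι → Coord n →₀ ℤ) {x : ι} (hx : x ∈ s) (hle : ∀ y ∈ s, e x ≤ e y) :
    val (∑ y ∈ s, (AddMonoidAlgebra.single (e y) 1 : TorusRing n)) = e x := by
  -- Coefficients are cardinalities, hence nonzero in `ℂ` as soon as the exponent occurs.
  have hcoeff : ∀ m, (∑ y ∈ s, (AddMonoidAlgebra.single (e y) 1 : TorusRing n)).coeff m
      = ((s.filter fun y => e y = m).card : ℂ) := by
    intro m
    rw [AddMonoidAlgebra.coeff_sum, Finsupp.finsetSum_apply, Finset.card_filter]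
    push_cast
    exact Finset.sum_congr rfl fun y _ => by
      rw [AddMonoidAlgebra.coeff_single, Finsupp.single_apply]
  have hmem : ∀ m, m ∈ (∑ y ∈ s, (AddMonoidAlgebra.single (e y) 1 : TorusRing n)).coeff.support
      ↔ ∃ y ∈ s, e y = m := by
    intro m
    rw [Finsupp.mem_support_iff, hcoeff, Nat.cast_ne_zero, ← Nat.pos_iff_ne_zero,
      Finset.card_pos, Finset.filter_nonempty_iff]
  have hx' := Finset.mem_image_of_mem toLex ((hmem _).2 ⟨x, hx, rfl⟩)
  rw [val, dif_pos ⟨_, hx'⟩]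
  refine congrArg ofLex ((Finset.min'_eq_iff _ _ (toLex (e x))).2 ⟨hx', fun b hb => ?_⟩)
  obtain ⟨m, hm, rfl⟩ := Finset.mem_image.1 hb
  obtain ⟨y, hy, rfl⟩ := (hmem m).1 hm
  exact Finsupp.toLex_monotone (hle y hy)

open Classical in
/-- The exponent vector of the product of the variables of the faces with a given property. -/
noncomputable def faceExponent (P : Face n → Prop) : Coord n →₀ ℤ :=
  ∑ f ∈ Finset.univ.filter P, Finsupp.single f.coord 1

theorem faceExponent_mono {P Q : Face n → Prop} (h : ∀ f, P f → Q f) :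
    faceExponent P ≤ faceExponent Q := by
  classical
  rw [faceExponent, faceExponent]
  refine Finset.sum_le_sum_of_subset_of_nonneg (Finset.monotone_filter_right _ fun f _ => h f) fun f _ _ => ?_
  intro c
  rw [Finsupp.single_apply]
  split_ifs <;> simp

theorem aeval_pathWeight (p : SimpleSeq n) :
    MvPolynomial.aeval
      (fun f : Face n => (AddMonoidAlgebra.single (Finsupp.single f.coord 1) 1 : TorusRing n))
      (pathWeight p) = AddMonoidAlgebra.single (faceExponent (LeftOf p)) 1 := by
  classical
  rw [pathWeight, map_prod, faceExponent]
  simp only [MvPolynomial.aeval_X]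
  induction Finset.univ.filter (LeftOf p) using Finset.induction_on with
  | empty => simp [AddMonoidAlgebra.one_def]
  | insert f s hf ih =>
    rw [Finset.prod_insert hf, Finset.sum_insert hf, ih, AddMonoidAlgebra.single_mul_single,
      one_mul]

/-- The set of faces on the left of the hugging path is contained in that of every other path, so
the choice of the order is irrelevant. -/
theorem val_pluecker_nearSquare [LinearOrder (Coord n)] {i j : ℕ} (hi : i < n) (hj : j < n) :
    val (pluecker n (subsetOf n (nearSquare n i j)))
      = faceExponent fun f : Face n => ¬ InRect i j f := by
  classical
  have hk : ((⟨j, by omega⟩ : Fin (2 * n)) : ℕ) = j := rfl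
  have hl : ((⟨2 * n - 1 - i, by omega⟩ : Fin (2 * n)) : ℕ) + 1 + i = 2 * n := by
    simp only; omega
  generalize (⟨j, _⟩ : Fin (2 * n)) = k at hk
  generalize (⟨2 * n - 1 - i, _⟩ : Fin (2 * n)) = l at hl
  obtain ⟨p, hp, hleft⟩ := exists_isPath hi hj k l hk hl
  rw [pluecker, flowPoly_nearSquare hi hj k l hk hl, map_sum]
  simp only [aeval_pathWeight]
  rw [val_sum_single _ (fun q => faceExponent (LeftOf q)) (x := p) (by simpa using hp)]
  · exact le_antisymm (faceExponent_mono hleft)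
      (faceExponent_mono fun f hf => hp.leftOf hk hj hi hl hf)
  · intro q hq
    rw [Finset.mem_filter] at hq
    exact faceExponent_mono fun f hf => hq.2.leftOf hk hj hi hl (hleft f hf)

/-! ### Face labels -/

theorem mem_rectCompl {i j : ℕ} {c : ℕ × ℕ} :
    c ∈ rectCompl n i j ↔ (c.1 < n ∧ c.2 < n) ∧ (c.1 < i ∨ c.2 < j) := by
  rw [← YoungDiagram.mem_cells]
  simp [rectCompl]

theorem transpose_rectCompl (i j : ℕ) : (rectCompl n i j).transpose = rectCompl n j i := by
  ext c
  simp only [YoungDiagram.mem_cells, YoungDiagram.mem_transpose, mem_rectCompl, Prod.fst_swap,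
    Prod.snd_swap]
  omega

theorem Face.label_injective : Function.Injective (Face.label (n := n)) := by
  have key : ∀ {a b c d : ℕ}, a < n → b < n → rectCompl n a b = rectCompl n c d →
      c ≤ a ∧ d ≤ b := by
    intro a b c d ha hb h
    have h1 : ∀ x : ℕ × ℕ, x ∈ rectCompl n a b ↔ x ∈ rectCompl n c d := fun x => by rw [h]
    simp only [mem_rectCompl] at h1
    -- These two boxes lie outside the first diagram, hence outside the second.
    have h2 := h1 (a, n - 1)
    have h3 := h1 (n - 1, b)
    omega
  rintro (_ | ⟨a, b⟩) (_ | ⟨c, d⟩) h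
  · rfl
  · have := key c.isLt d.isLt h.symm
    omega
  · have := key a.isLt b.isLt h
    omega
  · have h1 := key a.isLt b.isLt h
    have h2 := key c.isLt d.isLt h.symm
    simp only [Face.cell.injEq, Fin.ext_iff]
    omega

theorem coord_eq_iff {f g : Face n} :
    f.coord = g.coord ↔ f.label = g.label ∨ f.label = g.label.transpose :=
  Quotient.eq (r := faceSetoid n)

theorem coord_eq_outer_iff {f : Face n} : f.coord = (Face.outer : Face n).coord ↔ f = .outer := by
  rw [coord_eq_iff, show (Face.outer : Face n).label = rectCompl n n n from rfl,
    transpose_rectCompl, or_self]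
  exact Face.label_injective.eq_iff (b := .outer)

theorem coord_eq_cell_iff {f : Face n} {a b : Fin n} :
    f.coord = (Face.cell a b).coord ↔ f = .cell a b ∨ f = .cell b a := by
  rw [coord_eq_iff, show (Face.cell a b).label = rectCompl n a b from rfl, transpose_rectCompl]
  exact or_congr (Face.label_injective.eq_iff (b := .cell a b))
    (Face.label_injective.eq_iff (b := .cell b a))

theorem faceExponent_apply (P : Face n → Prop) [DecidablePred P] [DecidableEq (Coord n)]
    (c : Coord n) :
    faceExponent P c = ∑ f : Face n, if f.coord = c ∧ P f then 1 else 0 := by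
  classical
  rw [faceExponent, Finsupp.finsetSum_apply, Finset.sum_filter]
  refine Finset.sum_congr rfl fun f _ => ?_
  rw [Finsupp.single_apply]
  by_cases h1 : P f <;> by_cases h2 : f.coord = c <;> simp [h1, h2]

/-- The entry of `M n` in the row `(b, a)` and the column `(i, j)`. -/
def entry (n i j b a : ℕ) : ℤ :=
  if a = n then 1 else
    (if a ≤ j ∧ b ≤ i then 0 else 1) + if a = b ∨ (b ≤ j ∧ a ≤ i) then 0 else 1

/-- A coordinate collects the two faces `cell a b` and `cell b a`, which coincide on the diagonal;
the full square belongs to the outer face only, which is never in the rectangle. -/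
theorem faceExponent_faceOf {i j a b : ℕ} (hb : b < n) (ha : a ≤ n) :
    faceExponent (fun f : Face n => ¬ InRect i j f) (faceOf n a b).coord = entry n i j b a := by
  classical
  rw [faceExponent_apply, faceOf, entry]
  by_cases han : a = n
  · rw [dif_neg (by omega), if_pos han, Finset.sum_eq_single .outer]
    · simp [InRect]
    · intro f _ hf
      rw [coord_eq_outer_iff, if_neg (by tauto)]
    · simp
  rw [dif_pos ⟨by omega, hb⟩, if_neg han]
  simp only [coord_eq_cell_iff]
  by_cases hab : a = b
  · subst hab
    rw [Finset.sum_eq_single (.cell ⟨a, hb⟩ ⟨a, hb⟩)]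
    · simp only [InRect, true_and, or_self, true_or, if_true, add_zero]
      split_ifs <;> omega
    · intro f _ hf
      rw [if_neg (by tauto)]
    · simp
  · rw [← Finset.sum_subset (Finset.subset_univ {.cell ⟨a, by omega⟩ ⟨b, hb⟩,
      .cell ⟨b, hb⟩ ⟨a, by omega⟩}), Finset.sum_pair (by simp [hab])]
    · simp only [InRect, hab, true_or, or_true, true_and, false_or]
      split_ifs <;> omega
    · intro f _ hf
      simp only [Finset.mem_insert, Finset.mem_singleton] at hf
      rw [if_neg (by tauto)]

/-! ### The columns generate the lattice -/

/-- The pair which labels the `k`-th row. -/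
def rowPair (n : ℕ) (k : Fin ((n + 1).choose 2)) : ℕ × ℕ :=
  ofLex ((rowPairs n).orderEmbOfFin (card_rowPairs n) k)

theorem rowPair_injective : Function.Injective (rowPair n) :=
  fun _ _ h => ((rowPairs n).orderEmbOfFin (card_rowPairs n)).injective (ofLex.injective h)

theorem rowPair_mem (k : Fin ((n + 1).choose 2)) :
    ((rowPair n k).1 ≤ (rowPair n k).2 ∧ (rowPair n k).2 < n ∧ rowPair n k ≠ (0, 0)) ∨
      ((rowPair n k).1 + 1 = n ∧ (rowPair n k).2 = n) := by
  have h := (rowPairs n).orderEmbOfFin_mem (card_rowPairs n) k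
  obtain ⟨p, hp, h⟩ := Finset.mem_image.1 h
  rw [rowPair, ← h]
  exact (Finset.mem_filter.1 hp).2

theorem rowCoord_eq (r : Fin ((n + 1).choose 2)) :
    rowCoord n r = (faceOf n (rowPair n r).2 (rowPair n r).1).coord := rfl

theorem exists_colDiagram {i j : ℕ} (hij : i ≤ j) (hj : j < n) :
    ∃ c, colDiagram n c = nearSquare n i j := by
  have hmem : (toLex (i, OrderDual.toDual j) : ℕ ×ₗ ℕᵒᵈ) ∈ colPairs n :=
    Finset.mem_image.2 ⟨(i, j), by
      simp only [Finset.mem_filter, Finset.mem_product, Finset.mem_range]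
      omega, rfl⟩
  rw [← Finset.mem_coe, ← (colPairs n).range_orderEmbOfFin (card_colPairs n)] at hmem
  obtain ⟨c, hc⟩ := hmem
  refine ⟨c, ?_⟩
  simp only [colDiagram, hc, ofLex_toLex, OrderDual.ofDual_toDual]

theorem M_apply [LinearOrder (Coord n)] (r c : Fin ((n + 1).choose 2)) :
    M n r c = val (pluecker n (subsetOf n (colDiagram n c))) (rowCoord n r) := by
  simp only [M, Matrix.of_apply]

theorem M_apply_of_colDiagram [LinearOrder (Coord n)] {i j : ℕ} (hij : i ≤ j) (hj : j < n)
    {c : Fin ((n + 1).choose 2)} (hc : colDiagram n c = nearSquare n i j)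
    (r : Fin ((n + 1).choose 2)) :
    M n r c = entry n i j (rowPair n r).1 (rowPair n r).2 := by
  have h := rowPair_mem r
  rw [M_apply, hc, val_pluecker_nearSquare (by omega) hj, rowCoord_eq,
    faceExponent_faceOf (by omega) (by omega)]

theorem eq_top_of_entry_mem (S : Submodule ℤ (Fin ((n + 1).choose 2) → ℤ)) (hn : 1 ≤ n)
    (hV : ∀ i j, i ≤ j → j < n →
      (fun r => entry n i j (rowPair n r).1 (rowPair n r).2) ∈ S) : S = ⊤ := by
  -- Lowering `j` to `j - 1` takes only the faces with `a = j`, `b ≤ i` out of the rectangle. Their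
  -- transposes lie outside both rectangles because `i < j`.
  have hC : ∀ i j, i < j → j < n →
      (fun r => if (rowPair n r).2 = j ∧ (rowPair n r).1 ≤ i then (1 : ℤ) else 0) ∈ S := by
    intro i j hij hj
    convert S.sub_mem (hV i (j - 1) (by omega) (by omega)) (hV i j (by omega) hj) using 1
    ext r
    have := rowPair_mem r
    simp only [Pi.sub_apply, entry]
    split_ifs <;> omega
  have hE : ∀ i j, i ≤ j → j < n → (i, j) ≠ (0, 0) →
      (fun r => if rowPair n r = (i, j) then (1 : ℤ) else 0) ∈ S := by
    intro i j hij hj h0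
    rcases hij.lt_or_eq with hlt | rfl
    · by_cases hi : i = 0
      · convert hC i j hlt hj using 1
        ext r
        simp only [Prod.ext_iff]
        split_ifs <;> omega
      · convert S.sub_mem (hC i j hlt hj) (hC (i - 1) j (by omega) hj) using 1
        ext r
        simp only [Pi.sub_apply, Prod.ext_iff]
        split_ifs <;> omega
    · have hi : i ≠ 0 := by rintro rfl; exact h0 rfl
      -- Passing from `(i, i)` to `(i - 1, i)` removes the diagonal face `(i, i)` and the faces
      -- `cell b i` with `b < i`. The latter contribute the vector of `hC (i - 1) i`.
      convert S.sub_mem (S.sub_mem (hV (i - 1) i (by omega) hj) (hV i i le_rfl hj))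
        (hC (i - 1) i (by omega) hj) using 1
      ext r
      have := rowPair_mem r
      simp only [Pi.sub_apply, Prod.ext_iff, entry]
      split_ifs <;> omega
  have hsingle : ∀ r, (rowPair n r).2 < n → Pi.single r (1 : ℤ) ∈ S := by
    intro r hr
    have := rowPair_mem r
    convert hE (rowPair n r).1 (rowPair n r).2 (by omega) hr (by
      rcases this with h | h
      · exact h.2.2
      · omega) using 1
    ext r'
    rw [Pi.single_apply]
    exact if_congr (rowPair_injective.eq_iff (a := r') (b := r)).symm rfl rfl
  have hall : ∀ r, Pi.single r (1 : ℤ) ∈ S := by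
    intro r
    by_cases hr : (rowPair n r).2 < n
    · exact hsingle r hr
    have hr' := rowPair_mem r
    -- The row of the full square has entry `1` in every column, so its basis vector is the column
    -- `(0, 0)` minus a combination of the basis vectors already found.
    have h1 := pi_eq_sum_univ' (fun s => entry n 0 0 (rowPair n s).1 (rowPair n s).2)
    rw [← Finset.add_sum_erase _ _ (Finset.mem_univ r), entry, if_pos (by omega), one_smul,
      ← sub_eq_iff_eq_add] at h1
    rw [← h1]
    refine S.sub_mem (hV 0 0 le_rfl hn) (S.sum_mem fun s hs => S.smul_mem _ (hsingle s ?_))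
    have hs' := rowPair_mem s
    by_contra hlt
    exact (Finset.mem_erase.1 hs).1 (rowPair_injective (Prod.ext (by omega) (by omega)))
  rw [eq_top_iff]
  intro v _
  rw [pi_eq_sum_univ' v]
  exact S.sum_mem fun r _ => S.smul_mem _ (hall r)

/-- The range of the matrix is spanned by its columns, and a surjective square integer matrix is
invertible. -/
theorem isUnit_det_M [LinearOrder (Coord n)] (hn : 1 ≤ n) : IsUnit (M n).det := by
  rw [← Matrix.isUnit_iff_isUnit_det, ← Matrix.mulVec_surjective_iff_isUnit,
    ← Matrix.coe_mulVecLin, ← LinearMap.range_eq_top]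
  refine eq_top_of_entry_mem _ hn fun i j hij hj => ?_
  obtain ⟨c, hc⟩ := exists_colDiagram hij hj
  refine ⟨Pi.single c 1, ?_⟩
  rw [Matrix.mulVecLin_apply, Matrix.mulVec_single_one]
  ext r
  rw [Matrix.col_apply, M_apply_of_colDiagram hij hj hc]

end CoRect

theorem mainTheorem3 (n : ℕ) (hn : 1 ≤ n) [LinearOrder (CoRect.Coord n)] :
    ((CoRect.M n).det = 1 ∨ (CoRect.M n).det = -1) ∧
      ∃ L : Matrix (Fin ((n + 1).choose 2)) (Fin ((n + 1).choose 2)) ℤ,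
        Relation.ReflTransGen CoRect.ColStep (CoRect.M n) L ∧
          (∀ i j, i < j → L i j = 0) ∧ ∀ i, L i i = 1 :=
  ⟨Int.isUnit_iff.1 (CoRect.isUnit_det_M hn),
    CoRect.exists_lower_unitriangular _ (CoRect.isUnit_det_M hn)⟩
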